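/- A permutation of length $n\ge 0$ is a bijection of $\{1,\dots,n\}$; $\sigma$ is contained in $\pi$ ($\sigma\le\pi$) if $\pi$ has a subsequence order isomorphic to $\sigma$, and a permutation class is a set of permutations closed downward under containment. For a class $\mathcal C$ let $\mathcal C_n$ be the set of its members of length $n$, and let $\overline{\mathrm{gr}}(\mathcal C)=\limsup_{n\to\infty}|\mathcal C_n|^{1/n}\in[0,\infty]$; if this equals $\liminf_{n\to\infty}|\mathcal C_n|^{1/n}$, the common value is the growth rate $\mathrm{gr}(\mathcal C)$. Let $\mathrm{Sub}(\pi)=\{\sigma:\sigma\le\pi\}$. The sum $\pi\oplus\sigma$ (skew sum $\pi\ominus\sigma$) places a copy of $\sigma$ above (below) and to the right of $\pi$; $\bigoplus\mathcal C$ and $\bigominus\mathcal C$ denote the smallest class containing $\mathcal C$ that is closed under $\oplus$, respectively $\ominus$. For real $\gamma$ let $$\mathcal G_\gamma=\{\pi : \mathrm{gr}(\textstyle\bigoplus\mathrm{Sub}(\pi))<\gamma \text{ or } \mathrm{gr}(\bigominus\mathrm{Sub}(\pi))<\gamma\}.$$ A class $\mathcal C$ is $\mathcal G$-griddable, for a class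 $\mathcal G$, if there are positive integers $t,u$ such that every $\pi\in\mathcal C$, of length $n$ say, admits column divisions $1=c_1\le\cdots\le c_{t+1}=n+1$ and row divisions $1=r_1\le\cdots\le r_{u+1}=n+1$ for which, for all $i\le t$ and $j\le u$, the entries of $\pi$ with position in $[c_i,c_{i+1})$ and value in $[r_j,r_{j+1})$ form a subsequence order isomorphic to a member of $\mathcal G$. **Proposition.** Let $\gamma>1$ be a real number. Then $\mathcal G_\gamma$ is a permutation class, and every permutation class $\mathcal C$ with $\overline{\mathrm{gr}}(\mathcal C)<\gamma$ is $\mathcal G_\gamma$-griddable. -/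

import Mathlib

/-- A (finite) permutation: a length `n` together with a bijection of `Fin n`
(positions and values are numbered from `0`). The empty permutation is included. -/
structure FinPerm where
  len : ℕ
  perm : Equiv.Perm (Fin len)

namespace FinPerm

/-- The containment order: `σ ≤ π` if `π` has a subsequence order isomorphic to `σ`;
the order embedding `f` picks out the positions of this subsequence. -/
instance : Preorder FinPerm where
  le σ π := ∃ f : Fin σ.len ↪o Fin π.len,
    ∀ i j, σ.perm i < σ.perm j ↔ π.perm (f i) < π.perm (f j)
  le_refl _ := ⟨RelEmbedding.refl _, fun _ _ => Iff.rfl⟩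
  le_trans _ _ _ := fun ⟨f, hf⟩ ⟨g, hg⟩ =>
    ⟨f.trans g, fun i j => (hf i j).trans (hg (f i) (f j))⟩

/-- The sum `π ⊕ σ`: the entries of `σ` are placed above and to the right of those of `π`. -/
def sum (π σ : FinPerm) : FinPerm where
  len := π.len + σ.len
  perm := finSumFinEquiv.permCongr (Equiv.sumCongr π.perm σ.perm)

/-- The skew sum `π ⊖ σ`: the entries of `σ` are placed below and to the right of those of `π`.
It arises from `π ⊕ σ` by interchanging the low values (those of `π`) with the high values
(those of `σ`). -/
def skewSum (π σ : FinPerm) : FinPerm where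
  len := π.len + σ.len
  perm := (π.sum σ).perm.trans
    (finAddFlip.trans (finCongr (Nat.add_comm σ.len π.len)))

/-- The permutation order isomorphic to the subsequence of `π` in the positions `S`. -/
def pattern (π : FinPerm) (S : Finset (Fin π.len)) : FinPerm where
  len := S.card
  perm := (S.orderIsoOfFin rfl).toEquiv.trans
    ((π.perm.subtypeEquiv (fun _ => (Finset.mem_map' π.perm.toEmbedding).symm)).trans
      ((S.map π.perm.toEmbedding).orderIsoOfFin (Finset.card_map _)).symm.toEquiv)

/-- `π([a, b) × [c, d))`: the permutation order isomorphic to the subsequence of those entries of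
`π` whose position lies in `[a, b)` and whose value lies in `[c, d)`. -/
def box (π : FinPerm) (a b c d : ℕ) : FinPerm :=
  π.pattern {p | (a ≤ (p : ℕ) ∧ (p : ℕ) < b) ∧ c ≤ (π.perm p : ℕ) ∧ (π.perm p : ℕ) < d}

end FinPerm

/-- A permutation class: a set of permutations closed downward under containment. -/
abbrev PermClass := LowerSet FinPerm

namespace PermClass

/-- `|C_n|`, the number of permutations of length `n` in `C`. -/
noncomputable def count (C : PermClass) (n : ℕ) : ℕ :=
  Nat.card {p : Equiv.Perm (Fin n) // (⟨n, p⟩ : FinPerm) ∈ C}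

/-- `limsup |C_n|^(1/n)`, possibly infinite. -/
noncomputable def upperGrowthRate (C : PermClass) : EReal :=
  Filter.limsup (fun n : ℕ => (((count C n : ℝ) ^ (1 / (n : ℝ)) : ℝ) : EReal)) Filter.atTop

/-- `liminf |C_n|^(1/n)`, possibly infinite. -/
noncomputable def lowerGrowthRate (C : PermClass) : EReal :=
  Filter.liminf (fun n : ℕ => (((count C n : ℝ) ^ (1 / (n : ℝ)) : ℝ) : EReal)) Filter.atTop

/-- `C` has a (proper, possibly infinite) growth rate, and it is `g`. -/
def HasGrowthRate (C : PermClass) (g : EReal) : Prop :=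
  upperGrowthRate C = g ∧ lowerGrowthRate C = g

def SumClosed (C : PermClass) : Prop := ∀ π ∈ C, ∀ σ ∈ C, FinPerm.sum π σ ∈ C

def SkewClosed (C : PermClass) : Prop := ∀ π ∈ C, ∀ σ ∈ C, FinPerm.skewSum π σ ∈ C

/-- The smallest sum closed class containing `C`. -/
def sumClosure (C : PermClass) : PermClass := sInf {D : PermClass | SumClosed D ∧ C ≤ D}

/-- The smallest skew closed class containing `C`. -/
def skewClosure (C : PermClass) : PermClass := sInf {D : PermClass | SkewClosed D ∧ C ≤ D}

/-- The class of all permutations contained in `π`. -/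
def Sub (π : FinPerm) : PermClass := LowerSet.Iic π

/-- The set of permutations `π` for which the sum closure or the skew closure of `Sub π` has
growth rate less than `γ`. -/
def cellSet (γ : ℝ) : Set FinPerm :=
  {π | (∃ g : EReal, HasGrowthRate (sumClosure (Sub π)) g ∧ g < (γ : EReal)) ∨
    (∃ g : EReal, HasGrowthRate (skewClosure (Sub π)) g ∧ g < (γ : EReal))}

/-- An `M`-gridding of `π`, for a matrix `M` of classes with `t` columns and `u` rows (the first
index is the column, as in Cartesian coordinates): column divisions `c` and row divisions `r`
such that every cell contains a member of the corresponding class. As positions and values are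
numbered from `0`, the divisions run from `0` to the length of `π`. -/
def IsGridding {t u : ℕ} (M : Matrix (Fin t) (Fin u) PermClass) (π : FinPerm)
    (c : Fin (t + 1) → ℕ) (r : Fin (u + 1) → ℕ) : Prop :=
  Monotone c ∧ c 0 = 0 ∧ c (Fin.last t) = π.len ∧
  Monotone r ∧ r 0 = 0 ∧ r (Fin.last u) = π.len ∧
  ∀ (i : Fin t) (j : Fin u), π.box (c i.castSucc) (c i.succ) (r j.castSucc) (r j.succ) ∈ M i j

/-- The grid class of `M`. -/
def Grid {t u : ℕ} (M : Matrix (Fin t) (Fin u) PermClass) : Set FinPerm :=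
  {π | ∃ c r, IsGridding M π c r}

/-- `C` is `G`-griddable: `C` is contained in the grid class of some finite (nonempty) matrix all
of whose entries are equal to `G`. -/
def IsGriddable (C G : PermClass) : Prop :=
  ∃ t u : ℕ, 0 < t ∧ 0 < u ∧ ∃ M : Matrix (Fin t) (Fin u) PermClass,
    (∀ i j, M i j = G) ∧ (C : Set FinPerm) ⊆ Grid M

end PermClass

/-! For a permutation `π`, let `w(π)` be the sum of `γ⁻¹ ^ |τ|` over its sum indecomposable patterns
`τ`. Members of the sum closure of `Sub π` are sequences of such `τ`, so `w(π) < 1` forces growth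
rate below `γ` (`upperGrowthRate_sumClosure_lt`). Hence a permutation outside `cellSet γ` has `w ≥
1`, and so does its complement (`one_le_indecWeight`).

Now let `C` have upper growth rate below `γ`. The sum of `γ⁻¹ ^ |σ|` over `σ ∈ C` converges. If `C`
contained a sum of `m` bad permutations, those with `w ≥ 1`, then the sums of indecomposables chosen
from its initial summands would all lie in `C`, be distinct, and contribute more than `m` to this
series. So `m` is bounded (`exists_forall_sumList_notMem`), and by complementation the same holds
for skew sums.

Finally, call a rectangle of `π` bad if its contents lie outside `cellSet γ`. A greedy subdivision
in both directions yields either a grid of bounded size without bad cells or `N` vertical slabs each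
with `N` stacked bad rectangles (`exists_array_or_grid`). In the latter case one rectangle per slab
can be chosen with disjoint value intervals, and Ramsey's theorem extracts a long monotone chain of
bad rectangles (`exists_monotone_boxes`), a forbidden sum or skew sum.

Since growth rates of the closures exist by Fekete's lemma, `cellSet γ` is governed by upper growth
rates alone, which are monotone; this makes it a class. -/

namespace FinPerm

/-! ### Copies, containment and sums -/

/-- The one-line notation of `π` as a function on `ℕ`, extended by the identity. -/
def val (π : FinPerm) (i : ℕ) : ℕ := if h : i < π.len then (π.perm ⟨i, h⟩ : ℕ) else i

theorem val_of_lt (π : FinPerm) {i : ℕ} (h : i < π.len) : π.val i = π.perm ⟨i, h⟩ := dif_pos h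

theorem val_coe (π : FinPerm) (i : Fin π.len) : π.val i = π.perm i := π.val_of_lt i.2

theorem val_lt (π : FinPerm) {i : ℕ} (h : i < π.len) : π.val i < π.len := by
  rw [val_of_lt π h]; exact Fin.is_lt _

theorem val_injOn (π : FinPerm) {i j : ℕ} (hi : i < π.len) (hj : j < π.len)
    (h : π.val i = π.val j) : i = j := by
  rw [val_of_lt π hi, val_of_lt π hj] at h
  simpa using π.perm.injective (Fin.ext h)

theorem ext_val {σ π : FinPerm} (hl : σ.len = π.len) (h : ∀ i < σ.len, σ.val i = π.val i) :
    σ = π := by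
  obtain ⟨n, p⟩ := σ
  obtain ⟨m, q⟩ := π
  obtain rfl : n = m := hl
  congr 1
  ext i
  have := h i i.2
  rwa [val_of_lt _ i.2, val_of_lt _ i.2] at this

/-- `f` lists the positions of a copy of `σ` in `π`. -/
def IsEmb (f : ℕ → ℕ) (σ π : FinPerm) : Prop :=
  (∀ i < σ.len, f i < π.len) ∧ (∀ i j, i < j → j < σ.len → f i < f j) ∧
    ∀ i j, i < σ.len → j < σ.len → (σ.val i < σ.val j ↔ π.val (f i) < π.val (f j))

theorem IsEmb.le {f : ℕ → ℕ} {σ π : FinPerm} (h : IsEmb f σ π) : σ ≤ π := by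
  obtain ⟨h1, h2, h3⟩ := h
  refine ⟨OrderEmbedding.ofStrictMono (fun i => ⟨f i, h1 i i.2⟩) fun i j hij => h2 i j hij j.2,
    fun i j => ?_⟩
  have := h3 i j i.2 j.2
  rw [val_of_lt _ i.2, val_of_lt _ j.2, val_of_lt _ (h1 i i.2), val_of_lt _ (h1 j j.2)] at this
  exact this

theorem exists_isEmb {σ π : FinPerm} (h : σ ≤ π) : ∃ f, IsEmb f σ π := by
  obtain ⟨f, hf⟩ := h
  refine ⟨fun i => if h : i < σ.len then f ⟨i, h⟩ else 0, ?_, ?_, ?_⟩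
  · intro i hi; simp [hi]
  · intro i j hij hj
    simp [hij.trans hj, hj, hij]
  · intro i j hi hj
    simp only [hi, hj, dif_pos, val_coe]
    rw [val_of_lt _ hi, val_of_lt _ hj]
    exact hf _ _

theorem len_le_of_le {σ π : FinPerm} (h : σ ≤ π) : σ.len ≤ π.len := by
  obtain ⟨f, -⟩ := h
  simpa using Fintype.card_le_of_injective f f.injective

/-- The only order automorphism of `Fin n` is the identity; this is applied first to positions, then
to values. -/
theorem eq_of_le_of_len_eq {σ π : FinPerm} (h : σ ≤ π) (hl : σ.len = π.len) : σ = π := by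
  obtain ⟨n, p⟩ := σ
  obtain ⟨m, q⟩ := π
  obtain rfl : n = m := hl
  obtain ⟨f, hf⟩ := h
  simp only at f hf
  have hid : ∀ i, f i = i := by
    intro i
    have hb : Function.Surjective f := Finite.surjective_of_injective f.injective
    have : RelIso.ofSurjective f hb = OrderIso.refl (Fin n) := Subsingleton.elim _ _
    have h2 := congrArg (fun g : Fin n ≃o Fin n => g i) this
    simpa using h2
  have hm : StrictMono fun i => q (p.symm i) := by
    intro i j hij
    have := hf (p.symm i) (p.symm j)
    simp only [Equiv.apply_symm_apply, hid] at this
    exact this.1 hij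
  have hs : Function.Surjective fun i => q (p.symm i) :=
    q.surjective.comp p.symm.surjective
  have key : hm.orderIsoOfSurjective _ hs = OrderIso.refl (Fin n) := Subsingleton.elim _ _
  congr 1
  ext i
  have h2 := congrArg (fun g : Fin n ≃o Fin n => g (p i)) key
  simp at h2
  rw [h2]

@[simp] theorem len_sum (σ τ : FinPerm) : (σ.sum τ).len = σ.len + τ.len := rfl

theorem permCongr_castAdd {m n : ℕ} (p : Equiv.Perm (Fin m)) (q : Equiv.Perm (Fin n)) (i : Fin m) :
    finSumFinEquiv.permCongr (Equiv.sumCongr p q) (Fin.castAdd n i) = Fin.castAdd n (p i) := by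
  simp [Equiv.permCongr_apply]

theorem permCongr_natAdd {m n : ℕ} (p : Equiv.Perm (Fin m)) (q : Equiv.Perm (Fin n)) (i : Fin n) :
    finSumFinEquiv.permCongr (Equiv.sumCongr p q) (Fin.natAdd m i) = Fin.natAdd m (q i) := by
  simp [Equiv.permCongr_apply]

theorem val_sum_left (σ τ : FinPerm) {i : ℕ} (hi : i < σ.len) : (σ.sum τ).val i = σ.val i := by
  rw [val_of_lt _ (show i < (σ.sum τ).len from Nat.lt_add_right _ hi), val_of_lt _ hi]
  exact congrArg Fin.val (permCongr_castAdd σ.perm τ.perm ⟨i, hi⟩)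

theorem val_sum_right (σ τ : FinPerm) {i : ℕ} (hi : i < τ.len) :
    (σ.sum τ).val (σ.len + i) = σ.len + τ.val i := by
  rw [val_of_lt _ (show σ.len + i < (σ.sum τ).len from Nat.add_lt_add_left hi _), val_of_lt _ hi]
  exact congrArg Fin.val (permCongr_natAdd σ.perm τ.perm ⟨i, hi⟩)

theorem isEmb_sum_left (σ τ : FinPerm) : IsEmb id σ (σ.sum τ) := by
  refine ⟨fun i hi => Nat.lt_add_right _ hi, fun i j h _ => h, fun i j hi hj => ?_⟩
  simp [val_sum_left, hi, hj]

theorem isEmb_sum_right (σ τ : FinPerm) : IsEmb (fun i => σ.len + i) τ (σ.sum τ) := by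
  refine ⟨fun i hi => Nat.add_lt_add_left hi _, fun i j h _ => Nat.add_lt_add_left h _,
    fun i j hi hj => ?_⟩
  simp [val_sum_right, hi, hj]

theorem left_le_sum (σ τ : FinPerm) : σ ≤ σ.sum τ := (isEmb_sum_left σ τ).le

theorem right_le_sum (σ τ : FinPerm) : τ ≤ σ.sum τ := (isEmb_sum_right σ τ).le

/-- Copies of `σ` and `τ` in `π`, the second above and to the right of the first, form a copy
of `σ ⊕ τ`. -/
theorem IsEmb.sum {σ τ π : FinPerm} {f g : ℕ → ℕ} (hf : IsEmb f σ π) (hg : IsEmb g τ π)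
    (hpos : ∀ i j, i < σ.len → j < τ.len → f i < g j)
    (hval : ∀ i j, i < σ.len → j < τ.len → π.val (f i) < π.val (g j)) :
    IsEmb (fun i => if i < σ.len then f i else g (i - σ.len)) (σ.sum τ) π := by
  obtain ⟨f1, f2, f3⟩ := hf
  obtain ⟨g1, g2, g3⟩ := hg
  have right : ∀ i, ¬ i < σ.len → i < (σ.sum τ).len → ∃ k < τ.len, i = σ.len + k :=
    fun i h1 h2 => ⟨i - σ.len, by simp at h2; omega, by omega⟩
  refine ⟨fun i hi => ?_, fun i j hij hj => ?_, fun i j hi hj => ?_⟩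
  · by_cases h : i < σ.len
    · simpa [h] using f1 i h
    · obtain ⟨k, hk, rfl⟩ := right i h hi
      simpa using g1 k hk
  · by_cases h : i < σ.len <;> by_cases h' : j < σ.len
    · simpa [h, h'] using f2 i j hij h'
    · obtain ⟨k, hk, rfl⟩ := right j h' hj
      simpa [h] using hpos i k h hk
    · omega
    · obtain ⟨k, hk, rfl⟩ := right j h' hj
      obtain ⟨l, hl, rfl⟩ := right i h (hij.trans hj)
      simpa using g2 l k (by omega) hk
  · by_cases h : i < σ.len <;> by_cases h' : j < σ.len
    · simpa [h, h', val_sum_left] using f3 i j h h'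
    · obtain ⟨k, hk, rfl⟩ := right j h' hj
      have := σ.val_lt h
      simp only [h, val_sum_left, hk, val_sum_right, if_true, h', if_false, Nat.add_sub_cancel_left,
        hval i k h hk, iff_true]
      omega
    · obtain ⟨k, hk, rfl⟩ := right i h hi
      have := σ.val_lt h'
      have h2 := hval j k h' hk
      simp only [h, val_sum_left, hk, val_sum_right, if_true, h', if_false, Nat.add_sub_cancel_left]
      omega
    · obtain ⟨k, hk, rfl⟩ := right j h' hj
      obtain ⟨l, hl, rfl⟩ := right i h hi
      simpa [val_sum_right, hk, hl] using g3 l k hl hk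

theorem sum_le_sum {σ σ' τ τ' : FinPerm} (h : σ ≤ σ') (h' : τ ≤ τ') : σ.sum τ ≤ σ'.sum τ' := by
  obtain ⟨f, hf⟩ := exists_isEmb h
  obtain ⟨g, hg⟩ := exists_isEmb h'
  refine (IsEmb.sum (f := f) (g := fun i => σ'.len + g i) (π := σ'.sum τ') ?_ ?_ ?_ ?_).le
  · refine ⟨fun i hi => Nat.lt_add_right _ (hf.1 i hi), hf.2.1, fun i j hi hj => ?_⟩
    rw [val_sum_left _ _ (hf.1 i hi), val_sum_left _ _ (hf.1 j hj)]
    exact hf.2.2 i j hi hj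
  · refine ⟨fun i hi => Nat.add_lt_add_left (hg.1 i hi) _,
      fun i j hij hj => Nat.add_lt_add_left (hg.2.1 i j hij hj) _, fun i j hi hj => ?_⟩
    rw [val_sum_right _ _ (hg.1 i hi), val_sum_right _ _ (hg.1 j hj), Nat.add_lt_add_iff_left]
    exact hg.2.2 i j hi hj
  · intro i j hi hj
    have := hf.1 i hi
    omega
  · intro i j hi hj
    rw [val_sum_left _ _ (hf.1 i hi), val_sum_right _ _ (hg.1 j hj)]
    have := σ'.val_lt (hf.1 i hi)
    omega

theorem sum_inj_of_len_eq {σ σ' τ τ' : FinPerm} (h : σ.sum τ = σ'.sum τ') (hl : σ.len = σ'.len) :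
    σ = σ' ∧ τ = τ' := by
  have hl' : τ.len = τ'.len := by
    have := congrArg len h
    simp at this
    omega
  refine ⟨ext_val hl fun i hi => ?_, ext_val hl' fun i hi => ?_⟩
  · rw [← val_sum_left σ τ hi, h, val_sum_left σ' τ' (hl ▸ hi)]
  · have h1 := val_sum_right σ τ hi
    rw [h, hl, val_sum_right σ' τ' (hl' ▸ hi)] at h1
    omega

/-! ### Patterns on sets of positions and in boxes -/

theorem len_pattern (π : FinPerm) (S : Finset (Fin π.len)) : (π.pattern S).len = S.card := rfl

theorem exists_isEmb_pattern (π : FinPerm) (S : Finset (Fin π.len)) :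
    ∃ f, IsEmb f (π.pattern S) π ∧ (∀ i < S.card, ∃ p ∈ S, f i = p) ∧
      ∀ p ∈ S, ∃ i < S.card, f i = p := by
  refine ⟨fun i => if h : i < S.card then S.orderEmbOfFin rfl ⟨i, h⟩ else 0, ⟨?_, ?_, ?_⟩, ?_, ?_⟩
  · intro i hi
    have hi : i < S.card := hi
    simp [hi]
  · intro i j hij hj
    have hj : j < S.card := hj
    simp [hij.trans hj, hj, hij]
  · intro i j hi hj
    have hi' : i < S.card := hi
    have hj' : j < S.card := hj
    simp only [hi', hj', dif_pos, val_coe]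
    rw [val_of_lt _ hi, val_of_lt _ hj]
    exact ((S.map π.perm.toEmbedding).orderIsoOfFin (Finset.card_map _)).symm.lt_iff_lt
  · intro i hi
    exact ⟨S.orderEmbOfFin rfl ⟨i, hi⟩, S.orderEmbOfFin_mem rfl _, by simp [hi]⟩
  · intro p hp
    have : p ∈ Set.range (S.orderEmbOfFin rfl) := by simpa using hp
    obtain ⟨i, rfl⟩ := this
    exact ⟨i, i.2, by simp⟩

theorem le_pattern {σ π : FinPerm} {f : ℕ → ℕ} (hf : IsEmb f σ π) {S : Finset (Fin π.len)}
    (hS : ∀ i < σ.len, ∃ p ∈ S, f i = p) : σ ≤ π.pattern S := by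
  obtain ⟨g, hg, -, hsurj⟩ := exists_isEmb_pattern π S
  have : ∀ i, ∃ k, i < σ.len → k < (π.pattern S).len ∧ g k = f i := by
    intro i
    by_cases hi : i < σ.len
    · obtain ⟨p, hp, hpi⟩ := hS i hi
      obtain ⟨k, hk, hkp⟩ := hsurj p hp
      exact ⟨k, fun _ => ⟨hk, by rw [hkp, hpi]⟩⟩
    · exact ⟨0, fun h => absurd h hi⟩
  choose k hk using this
  refine IsEmb.le (f := k) ⟨fun i hi => (hk i hi).1, fun i j hij hj => ?_, fun i j hi hj => ?_⟩
  · have hi := hij.trans hj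
    by_contra hlt
    have h1 := hf.2.1 i j hij hj
    rw [← (hk i hi).2, ← (hk j hj).2] at h1
    rcases (not_lt.1 hlt).eq_or_lt with h | h
    · simp [h] at h1
    · exact absurd (hg.2.1 _ _ h (hk i hi).1) h1.not_gt
  · rw [hg.2.2 _ _ (hk i hi).1 (hk j hj).1, (hk i hi).2, (hk j hj).2]
    exact hf.2.2 i j hi hj

theorem exists_isEmb_box (π : FinPerm) (a b c d : ℕ) :
    ∃ f, IsEmb f (π.box a b c d) π ∧ ∀ i < (π.box a b c d).len,
      a ≤ f i ∧ f i < b ∧ c ≤ π.val (f i) ∧ π.val (f i) < d := by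
  obtain ⟨f, hf, hmem, -⟩ := exists_isEmb_pattern π
    {p | (a ≤ (p : ℕ) ∧ (p : ℕ) < b) ∧ c ≤ (π.perm p : ℕ) ∧ (π.perm p : ℕ) < d}
  refine ⟨f, hf, fun i hi => ?_⟩
  obtain ⟨p, hp, hpi⟩ := hmem i hi
  simp only [Finset.mem_filter, Finset.mem_univ, true_and] at hp
  rw [hpi, val_coe]
  tauto

theorem box_mono (π : FinPerm) {a b c d a' b' c' d' : ℕ} (ha : a' ≤ a) (hb : b ≤ b')
    (hc : c' ≤ c) (hd : d ≤ d') : π.box a b c d ≤ π.box a' b' c' d' := by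
  obtain ⟨f, hf, h⟩ := exists_isEmb_box π a b c d
  refine le_pattern hf fun i hi => ⟨⟨f i, hf.1 i hi⟩, ?_, rfl⟩
  have := h i hi
  rw [val_of_lt _ (hf.1 i hi)] at this
  simp only [Finset.mem_filter, Finset.mem_univ, true_and]
  omega

theorem len_box_le_width (π : FinPerm) (a b c d : ℕ) : (π.box a b c d).len ≤ b - a := by
  obtain ⟨f, hf, h⟩ := exists_isEmb_box π a b c d
  have : (Finset.range (π.box a b c d).len).card ≤ (Finset.Ico a b).card := by
    refine Finset.card_le_card_of_injOn f ?_ ?_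
    · intro i hi
      have := h i (by simpa using hi)
      simp; omega
    · intro i hi j hj hij
      simp only [Finset.coe_range, Set.mem_Iio] at hi hj
      rcases lt_trichotomy i j with hlt | rfl | hlt
      · exact absurd hij (hf.2.1 i j hlt hj).ne
      · rfl
      · exact absurd hij (hf.2.1 j i hlt hi).ne'
  simpa using this

theorem len_box_le_height (π : FinPerm) (a b c d : ℕ) : (π.box a b c d).len ≤ d - c := by
  obtain ⟨f, hf, h⟩ := exists_isEmb_box π a b c d
  have : (Finset.range (π.box a b c d).len).card ≤ (Finset.Ico c d).card := by
    refine Finset.card_le_card_of_injOn (fun i => π.val (f i)) ?_ ?_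
    · intro i hi
      have := h i (by simpa using hi)
      simp; omega
    · intro i hi j hj hij
      simp only [Finset.coe_range, Set.mem_Iio] at hi hj
      have hij := π.val_injOn (hf.1 i hi) (hf.1 j hj) hij
      rcases lt_trichotomy i j with hlt | rfl | hlt
      · exact absurd hij (hf.2.1 i j hlt hj).ne
      · rfl
      · exact absurd hij (hf.2.1 j i hlt hi).ne'
  simpa using this

/-! ### Complementation -/

/-- The complement of `π`, which reverses the values. -/
def comp (π : FinPerm) : FinPerm := ⟨π.len, π.perm.trans Fin.revPerm⟩

@[simp] theorem len_comp (π : FinPerm) : π.comp.len = π.len := rfl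

@[simp] theorem comp_comp (π : FinPerm) : π.comp.comp = π := by
  obtain ⟨n, p⟩ := π
  simp only [comp]
  congr 1
  ext i
  simp

theorem val_comp (π : FinPerm) {i : ℕ} (hi : i < π.len) : π.comp.val i = π.len - 1 - π.val i := by
  rw [val_of_lt _ hi, val_of_lt (comp π) hi]
  change ((Fin.rev (π.perm ⟨i, hi⟩) : Fin π.len) : ℕ) = _
  rw [Fin.val_rev]
  omega

theorem IsEmb.comp {f : ℕ → ℕ} {σ π : FinPerm} (h : IsEmb f σ π) : IsEmb f σ.comp π.comp := by
  refine ⟨h.1, h.2.1, fun i j hi hj => ?_⟩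
  have hi : i < σ.len := hi
  have hj : j < σ.len := hj
  rw [val_comp _ hi, val_comp _ hj, val_comp _ (h.1 i hi), val_comp _ (h.1 j hj)]
  have := h.2.2 j i hj hi
  have := σ.val_lt hi
  have := σ.val_lt hj
  have := π.val_lt (h.1 i hi)
  have := π.val_lt (h.1 j hj)
  omega

theorem comp_le_comp {σ π : FinPerm} (h : σ ≤ π) : σ.comp ≤ π.comp := by
  obtain ⟨f, hf⟩ := exists_isEmb h
  exact hf.comp.le

theorem comp_le_iff {σ π : FinPerm} : σ.comp ≤ π ↔ σ ≤ π.comp :=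
  ⟨fun h => by simpa using comp_le_comp h, fun h => by simpa using comp_le_comp h⟩

theorem comp_skewSum (σ τ : FinPerm) : (σ.skewSum τ).comp = σ.comp.sum τ.comp := by
  refine congrArg (FinPerm.mk (σ.len + τ.len)) (Equiv.ext fun i => Fin.ext ?_)
  change ((Fin.rev (finCongr (Nat.add_comm τ.len σ.len) (finAddFlip
    (finSumFinEquiv.permCongr (Equiv.sumCongr σ.perm τ.perm) i))) : Fin (σ.len + τ.len)) : ℕ) =
    finSumFinEquiv.permCongr
      (Equiv.sumCongr (σ.perm.trans Fin.revPerm) (τ.perm.trans Fin.revPerm)) i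
  refine Fin.addCases (fun i => ?_) (fun i => ?_) i
  · rw [permCongr_castAdd, permCongr_castAdd]
    simp [Fin.val_rev]
    omega
  · rw [permCongr_natAdd, permCongr_natAdd]
    simp [Fin.val_rev]
    omega

theorem comp_sum (σ τ : FinPerm) : (σ.sum τ).comp = σ.comp.skewSum τ.comp := by
  rw [← comp_comp (σ.comp.skewSum τ.comp), comp_skewSum, comp_comp, comp_comp]

end FinPerm

/-! ### Decomposition into sum indecomposables -/

namespace FinPerm

/-- `τ` is nonempty and not a sum of two nonempty permutations. -/
def Indecomposable (τ : FinPerm) : Prop :=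
  0 < τ.len ∧ ∀ k, 0 < k → k < τ.len → ∃ i < k, ∃ j < τ.len, k ≤ j ∧ τ.val j < τ.val i

theorem exists_eq_sum_of_separated {σ : FinPerm} {k : ℕ} (hk : k ≤ σ.len)
    (h : ∀ i < k, ∀ j < σ.len, k ≤ j → σ.val i < σ.val j) :
    ∃ τ ρ : FinPerm, τ.len = k ∧ σ = τ.sum ρ := by
  obtain ⟨f, hf, hf', -⟩ := exists_isEmb_pattern σ {p | (p : ℕ) < k}
  obtain ⟨g, hg, hg', -⟩ := exists_isEmb_pattern σ {p | ¬ (p : ℕ) < k}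
  have hlen : (σ.pattern {p | (p : ℕ) < k}).len = k := by
    rw [len_pattern, Fin.card_filter_val_lt]
    omega
  refine ⟨_, _, hlen, (eq_of_le_of_len_eq (hf.sum hg ?_ ?_).le ?_).symm⟩
  · intro i j hi hj
    obtain ⟨p, hp, e⟩ := hf' i hi
    obtain ⟨q, hq, e'⟩ := hg' j hj
    simp at hp hq
    omega
  · intro i j hi hj
    obtain ⟨p, hp, e⟩ := hf' i hi
    obtain ⟨q, hq, e'⟩ := hg' j hj
    simp only [Finset.mem_filter, Finset.mem_univ, true_and, not_lt] at hp hq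
    rw [e, e']
    exact h p hp q q.2 hq
  · rw [len_sum, len_pattern, len_pattern, Finset.card_filter_add_card_filter_not]
    simp

/-- Cut at the least positive `k` whose initial segment lies below the rest: a finer cut of the
first summand would also be a cut of `σ`, against minimality. -/
theorem exists_eq_indecomposable_sum {σ : FinPerm} (hσ : 0 < σ.len) :
    ∃ τ ρ : FinPerm, τ.Indecomposable ∧ σ = τ.sum ρ := by
  classical
  have hex : ∃ k, 0 < k ∧ k ≤ σ.len ∧ ∀ i < k, ∀ j < σ.len, k ≤ j → σ.val i < σ.val j :=
    ⟨σ.len, hσ, le_rfl, fun i _ j hj hj' => absurd hj hj'.not_gt⟩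
  obtain ⟨h0, hle, hsep⟩ := Nat.find_spec hex
  have hmin : ∀ k < Nat.find hex, _ := fun k hk => Nat.find_min hex hk
  generalize Nat.find hex = k at *
  obtain ⟨τ, ρ, hτ, hs⟩ := exists_eq_sum_of_separated hle hsep
  refine ⟨τ, ρ, ⟨by omega, fun l hl hlt => ?_⟩, hs⟩
  by_contra hcon
  push Not at hcon
  refine hmin l (by omega) ⟨hl, by omega, fun i hi j hj hlj => ?_⟩
  by_cases hjk : j < k
  · have h1 := hcon i hi j (by omega) hlj
    rw [← val_sum_left τ ρ (by omega), ← val_sum_left τ ρ (by omega), ← hs] at h1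
    exact lt_of_le_of_ne h1 fun e => by
      have := σ.val_injOn (by omega) hj e
      omega
  · exact hsep i (by omega) j hj (by omega)

/-- If `τ` were shorter than `τ'`, its end would be a proper cut of `τ'`. Used in both directions,
this makes the first indecomposable summand unique. -/
theorem Indecomposable.len_le_of_sum_eq {τ τ' ρ ρ' : FinPerm} (h : τ'.Indecomposable)
    (hτ : 0 < τ.len) (he : τ.sum ρ = τ'.sum ρ') : τ'.len ≤ τ.len := by
  by_contra hlt
  obtain ⟨i, hi, j, hj, hkj, hlt'⟩ := h.2 τ.len hτ (by omega)
  have hl : τ.len + ρ.len = τ'.len + ρ'.len := congrArg len he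
  rw [← val_sum_left τ' ρ' hj, ← val_sum_left τ' ρ' (show i < τ'.len by omega), ← he,
    val_sum_left τ ρ hi] at hlt'
  obtain ⟨m, rfl⟩ := Nat.exists_eq_add_of_le hkj
  rw [val_sum_right τ ρ (by omega)] at hlt'
  have := τ.val_lt hi
  omega

theorem Indecomposable.sum_inj {τ τ' ρ ρ' : FinPerm} (h : τ.Indecomposable)
    (h' : τ'.Indecomposable) (he : τ.sum ρ = τ'.sum ρ') : τ = τ' ∧ ρ = ρ' :=
  sum_inj_of_len_eq he (le_antisymm (h.len_le_of_sum_eq h'.1 he.symm) (h'.len_le_of_sum_eq h.1 he))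

/-- A copy meeting both summands would be cut at the first position `k` sent into `ρ`, since
everything in `σ` lies below everything in `ρ`. -/
theorem Indecomposable.le_or_le_of_le_sum {τ σ ρ : FinPerm} (h : τ.Indecomposable)
    (hle : τ ≤ σ.sum ρ) : τ ≤ σ ∨ τ ≤ ρ := by
  obtain ⟨f, h1, h2, h3⟩ := exists_isEmb hle
  have hmono : ∀ i j, i ≤ j → j < τ.len → f i ≤ f j := fun i j hij hj => by
    rcases hij.eq_or_lt with rfl | hij
    · rfl
    · exact (h2 i j hij hj).le
  have hl : (σ.sum ρ).len = σ.len + ρ.len := rfl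
  by_cases hA : ∀ i < τ.len, f i < σ.len
  · left
    refine IsEmb.le (f := f) ⟨hA, h2, fun i j hi hj => ?_⟩
    rw [h3 i j hi hj, val_sum_left _ _ (hA i hi), val_sum_left _ _ (hA j hj)]
  by_cases hB : σ.len ≤ f 0
  · right
    have hB' : ∀ i < τ.len, σ.len ≤ f i := fun i hi => hB.trans (hmono 0 i (Nat.zero_le _) hi)
    refine IsEmb.le (f := fun i => f i - σ.len) ⟨fun i hi => ?_, fun i j hij hj => ?_,
      fun i j hi hj => ?_⟩
    · have := h1 i hi
      have := hB' i hi
      dsimp only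
      omega
    · have := h2 i j hij hj
      have := hB' i (hij.trans hj)
      dsimp only
      omega
    · have key : ∀ i < τ.len, (σ.sum ρ).val (f i) = σ.len + ρ.val (f i - σ.len) := fun i hi => by
        have := h1 i hi
        have := hB' i hi
        rw [← val_sum_right _ _ (by omega), Nat.add_sub_cancel' (hB' i hi)]
      rw [h3 i j hi hj, key i hi, key j hj, Nat.add_lt_add_iff_left]
  exfalso
  push Not at hA hB
  classical
  have hk := Nat.find_spec hA
  have hmin : ∀ k < Nat.find hA, _ := fun k hk => Nat.find_min hA hk
  generalize Nat.find hA = k at *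
  have hk0 : 0 < k := by
    rcases Nat.eq_zero_or_pos k with rfl | h
    · omega
    · exact h
  obtain ⟨i, hi, j, hj, hkj, hlt⟩ := h.2 k hk0 hk.1
  have hfi : f i < σ.len := by
    have := hmin i hi
    push Not at this
    exact this (by omega)
  have hfj : σ.len ≤ f j := hk.2.trans (hmono k j hkj hj)
  rw [h3 j i hj (by omega), val_sum_left _ _ hfi, ← Nat.add_sub_cancel' hfj,
    val_sum_right _ _ (by have := h1 j hj; omega)] at hlt
  have := σ.val_lt hfi
  omega

theorem finite_setOf_len_le (n : ℕ) : {σ : FinPerm | σ.len ≤ n}.Finite := by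
  refine (Set.finite_range fun x : Σ k : Fin (n + 1), Equiv.Perm (Fin k) =>
    (⟨x.1, x.2⟩ : FinPerm)).subset ?_
  rintro ⟨k, p⟩ hk
  exact ⟨⟨⟨k, Nat.lt_succ_of_le hk⟩, p⟩, rfl⟩

theorem finite_indecomposable_le (π : FinPerm) :
    {τ : FinPerm | τ.Indecomposable ∧ τ ≤ π}.Finite :=
  (finite_setOf_len_le π.len).subset fun _ h => len_le_of_le h.2

/-- The indecomposable permutations contained in `π`. -/
noncomputable def indecs (π : FinPerm) : Finset FinPerm := (finite_indecomposable_le π).toFinset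

@[simp] theorem mem_indecs {π τ : FinPerm} : τ ∈ π.indecs ↔ τ.Indecomposable ∧ τ ≤ π := by
  simp [indecs]

/-- The generating function of the indecomposable permutations contained in `π`. -/
noncomputable def indecWeight (π : FinPerm) (x : ℝ) : ℝ := ∑ τ ∈ π.indecs, x ^ τ.len

theorem eq_of_len_le_one {σ τ : FinPerm} (hl : σ.len = τ.len) (h : σ.len ≤ 1) : σ = τ :=
  ext_val hl fun i hi => by
    have h1 := σ.val_lt hi
    have h2 := τ.val_lt (hl ▸ hi)
    omega

theorem indecWeight_le_of_len_le_one {π : FinPerm} (hπ : π.len ≤ 1) {x : ℝ} (hx : 0 ≤ x) :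
    π.indecWeight x ≤ x := by
  have hlen : ∀ τ ∈ π.indecs, τ.len = 1 := fun τ hτ => by
    have h := mem_indecs.1 hτ
    have := len_le_of_le h.2
    have := h.1.1
    omega
  have hcard : π.indecs.card ≤ 1 := Finset.card_le_one.2 fun σ hσ τ hτ =>
    eq_of_len_le_one ((hlen σ hσ).trans (hlen τ hτ).symm) (hlen σ hσ).le
  calc π.indecWeight x = ∑ τ ∈ π.indecs, x := Finset.sum_congr rfl fun τ hτ => by simp [hlen τ hτ]
    _ = π.indecs.card * x := by simp
    _ ≤ 1 * x := by gcongr; exact_mod_cast hcard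
    _ = x := one_mul x

end FinPerm

/-! ### Sum closures and levels of a class -/

namespace PermClass

open FinPerm

theorem le_sumClosure (C : PermClass) : C ≤ sumClosure C := le_sInf fun _ hD => hD.2

theorem sumClosure_le {C D : PermClass} (h : SumClosed D) (h' : C ≤ D) : sumClosure C ≤ D :=
  sInf_le ⟨h, h'⟩

theorem sumClosed_sumClosure (C : PermClass) : SumClosed (sumClosure C) := by
  intro π hπ σ hσ
  simp only [sumClosure, LowerSet.mem_sInf_iff] at *
  exact fun D hD => hD.1 π (hπ D hD) σ (hσ D hD)

theorem sumClosure_mono {C D : PermClass} (h : C ≤ D) : sumClosure C ≤ sumClosure D :=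
  sumClosure_le (sumClosed_sumClosure D) (h.trans (le_sumClosure D))

/-- Taking closures creates no new indecomposables: the permutations whose indecomposable patterns
all lie below `π` form a sum closed class containing `Sub π`. -/
theorem le_of_mem_sumClosure_Sub {π σ τ : FinPerm} (hσ : σ ∈ sumClosure (Sub π))
    (hτ : τ.Indecomposable) (h : τ ≤ σ) : τ ≤ π := by
  let D : PermClass := ⟨{σ | ∀ τ : FinPerm, τ.Indecomposable → τ ≤ σ → τ ≤ π},
    fun a b hba ha τ hτ hb => ha τ hτ (hb.trans hba)⟩
  have hD : SumClosed D := fun a ha b hb τ hτ h =>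
    (hτ.le_or_le_of_le_sum h).elim (ha τ hτ) (hb τ hτ)
  exact sumClosure_le hD (fun a ha τ _ h => h.trans ha) hσ τ hτ h

theorem finite_level (C : PermClass) (n : ℕ) : {σ | σ ∈ C ∧ σ.len = n}.Finite :=
  (finite_setOf_len_le n).subset fun _ h => h.2.le

/-- The members of `C` of length `n`. -/
noncomputable def level (C : PermClass) (n : ℕ) : Finset FinPerm := (finite_level C n).toFinset

@[simp] theorem mem_level {C : PermClass} {n : ℕ} {σ : FinPerm} :
    σ ∈ level C n ↔ σ ∈ C ∧ σ.len = n := by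
  simp [level]

theorem card_level (C : PermClass) (n : ℕ) : (level C n).card = count C n := by
  rw [count, level, ← Nat.card_eq_card_finite_toFinset]
  refine (Nat.card_eq_of_bijective (fun p => ⟨⟨n, p.1⟩, p.2, rfl⟩) ⟨?_, ?_⟩).symm
  · rintro ⟨p, hp⟩ ⟨q, hq⟩ h
    simpa using h
  · rintro ⟨⟨m, p⟩, hp, hm⟩
    obtain rfl : m = n := hm
    exact ⟨⟨p, hp⟩, rfl⟩

theorem count_mono {C D : PermClass} (h : C ≤ D) (n : ℕ) : count C n ≤ count D n := by
  rw [← card_level, ← card_level]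
  exact Finset.card_le_card fun σ hσ => by
    rw [mem_level] at *
    exact ⟨h hσ.1, hσ.2⟩

end PermClass

/-! ### Counting, growth rates and the indecomposable weight -/

namespace PermClass

open FinPerm Filter Topology

theorem count_mul_count_le {C : PermClass} (hC : SumClosed C) (m n : ℕ) :
    count C m * count C n ≤ count C (m + n) := by
  rw [← card_level, ← card_level, ← card_level, ← Finset.card_product]
  refine Finset.card_le_card_of_injOn (fun x => x.1.sum x.2) ?_ ?_
  · rintro ⟨σ, τ⟩ h
    simp only [Finset.coe_product, Set.mem_prod, Finset.mem_coe, mem_level] at h ⊢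
    exact ⟨hC σ h.1.1 τ h.2.1, by simp [h.1.2, h.2.2]⟩
  · rintro ⟨σ, τ⟩ h ⟨σ', τ'⟩ h' he
    simp only [Finset.coe_product, Set.mem_prod, Finset.mem_coe, mem_level] at h h'
    obtain ⟨rfl, rfl⟩ := sum_inj_of_len_eq he (h.1.2.trans h'.1.2.symm)
    rfl

theorem one_le_count {C : PermClass} (hC : SumClosed C) {π : FinPerm} (hπ : π ∈ C)
    (h0 : 0 < π.len) (n : ℕ) : 1 ≤ count C n := by
  have hle : ∀ k ≤ 1, (⟨k, Equiv.refl _⟩ : FinPerm) ∈ C := fun k hk => by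
    refine C.lower (IsEmb.le (f := id) ⟨fun i (hi : i < k) => ?_, fun i j h _ => h,
      fun i j (hi : i < k) (hj : j < k) => ?_⟩) hπ
    · simp only [id]
      omega
    · obtain rfl : i = j := by omega
      simp
  have hlevel : ∀ k ≤ 1, 1 ≤ count C k := fun k hk => by
    rw [← card_level]
    exact Finset.card_pos.2 ⟨_, mem_level.2 ⟨hle k hk, rfl⟩⟩
  induction n with
  | zero => exact hlevel 0 (by omega)
  | succ n ih =>
    exact le_trans (by nlinarith [hlevel 1 le_rfl]) (count_mul_count_le hC n 1)

/-- Removing the first indecomposable summand bounds level `n` by the sum of the levels `n - |τ|`;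
after scaling by `x ^ n`, strong induction leaves at most the weight. -/
theorem count_sumClosure_mul_pow_le {π : FinPerm} {x : ℝ} (hx : 0 ≤ x)
    (hw : π.indecWeight x ≤ 1) (n : ℕ) : (count (sumClosure (Sub π)) n : ℝ) * x ^ n ≤ 1 := by
  classical
  set D := sumClosure (Sub π) with hD
  induction n using Nat.strong_induction_on with
  | _ n ih =>
  rcases Nat.eq_zero_or_pos n with rfl | hn
  · have : (level D 0).card ≤ 1 := Finset.card_le_one.2 fun σ hσ τ hτ => by
      rw [mem_level] at hσ hτ
      exact eq_of_len_le_one (hσ.2.trans hτ.2.symm) (by omega)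
    rw [card_level] at this
    simpa using this
  set I := π.indecs.filter fun τ => τ.len ≤ n with hI
  have hsub : level D n ⊆ I.biUnion fun τ => (level D (n - τ.len)).image τ.sum := by
    intro σ hσ
    rw [mem_level] at hσ
    obtain ⟨τ, ρ, hτ, rfl⟩ := exists_eq_indecomposable_sum (hσ.2 ▸ hn : 0 < σ.len)
    have hlen : τ.len + ρ.len = n := hσ.2
    rw [Finset.mem_biUnion]
    refine ⟨τ, ?_, Finset.mem_image.2 ⟨ρ, mem_level.2 ⟨D.lower (right_le_sum τ ρ) hσ.1, ?_⟩, rfl⟩⟩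
    · rw [hI, Finset.mem_filter, mem_indecs]
      exact ⟨⟨hτ, le_of_mem_sumClosure_Sub hσ.1 hτ (left_le_sum τ ρ)⟩, by omega⟩
    · omega
  have hcard : count D n ≤ ∑ τ ∈ I, count D (n - τ.len) := by
    rw [← card_level]
    refine (Finset.card_le_card hsub).trans (Finset.card_biUnion_le.trans ?_)
    refine Finset.sum_le_sum fun τ _ => ?_
    rw [← card_level]
    exact Finset.card_image_le
  calc (count D n : ℝ) * x ^ n ≤ (∑ τ ∈ I, (count D (n - τ.len) : ℝ)) * x ^ n := by
        gcongr
        exact_mod_cast hcard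
    _ = ∑ τ ∈ I, x ^ τ.len * ((count D (n - τ.len) : ℝ) * x ^ (n - τ.len)) := by
        rw [Finset.sum_mul]
        refine Finset.sum_congr rfl fun τ hτ => ?_
        have hle : τ.len ≤ n := (Finset.mem_filter.1 hτ).2
        rw [← Nat.add_sub_cancel' hle, pow_add, Nat.add_sub_cancel_left]
        ring
    _ ≤ ∑ τ ∈ I, x ^ τ.len := by
        refine Finset.sum_le_sum fun τ hτ => mul_le_of_le_one_right (by positivity) (ih _ ?_)
        have := (mem_indecs.1 (Finset.mem_filter.1 hτ).1).1.1
        omega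
    _ ≤ π.indecWeight x :=
        Finset.sum_le_sum_of_subset_of_nonneg (Finset.filter_subset _ _) fun _ _ _ => by positivity
    _ ≤ 1 := hw

theorem exists_indecWeight_le_one (π : FinPerm) : ∃ x : ℝ, 0 < x ∧ π.indecWeight x ≤ 1 := by
  refine ⟨1 / (π.indecs.card + 1), by positivity, ?_⟩
  have hx : (1 : ℝ) / (π.indecs.card + 1) ≤ 1 := by
    rw [div_le_one (by positivity)]
    simp
  calc _ ≤ ∑ τ ∈ π.indecs, (1 : ℝ) / (π.indecs.card + 1) :=
        Finset.sum_le_sum fun τ hτ =>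
          pow_le_of_le_one (by positivity) hx (mem_indecs.1 hτ).1.1.ne'
    _ = π.indecs.card / (π.indecs.card + 1) := by simp [div_eq_mul_inv]
    _ ≤ 1 := by
      rw [div_le_one (by positivity)]
      simp

theorem rpow_one_div_le {c y : ℝ} {n : ℕ} (hn : n ≠ 0) (hc : 0 ≤ c) (hy : 0 ≤ y) :
    c ^ (1 / (n : ℝ)) ≤ y ↔ c ≤ y ^ n := by
  rw [one_div, Real.rpow_inv_le_iff_of_pos hc hy (by positivity), Real.rpow_natCast]

/-- The growth rate of the sum closure of a principal class exists. -/
theorem exists_tendsto_count_sumClosure (π : FinPerm) : ∃ L : ℝ,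
    Tendsto (fun n : ℕ => (count (sumClosure (Sub π)) n : ℝ) ^ (1 / (n : ℝ))) atTop (𝓝 L) := by
  set D := sumClosure (Sub π) with hD
  -- For empty `π` the closure has no members of positive length, and logarithms of the counts would
  -- be useless.
  rcases Nat.eq_zero_or_pos π.len with h0 | h0
  · refine ⟨0, tendsto_const_nhds.congr' ?_⟩
    filter_upwards [eventually_ge_atTop 1] with n hn
    have : count D n = 0 := by
      rw [← card_level, Finset.card_eq_zero, Finset.eq_empty_iff_forall_notMem]
      intro σ hσ
      rw [mem_level] at hσ
      obtain ⟨τ, ρ, hτ, rfl⟩ := exists_eq_indecomposable_sum (show 0 < σ.len by omega)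
      have := len_le_of_le (le_of_mem_sumClosure_Sub hσ.1 hτ (left_le_sum τ ρ))
      have := hτ.1
      omega
    rw [this, Nat.cast_zero, Real.zero_rpow]
    positivity
  have hclosed : SumClosed D := sumClosed_sumClosure _
  have hpos : ∀ n, (1 : ℝ) ≤ count D n := fun n => by
    exact_mod_cast one_le_count hclosed (le_sumClosure (Sub π) (show π ∈ Sub π from le_refl π)) h0 n
  obtain ⟨x, hx, hw⟩ := exists_indecWeight_le_one π
  -- Fekete's lemma applies because concatenation makes the counts supermultiplicative.
  have hsub : Subadditive fun n => -Real.log (count D n) := fun m n => by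
    have : ((count D m : ℝ) * count D n) ≤ count D (m + n) := by
      exact_mod_cast count_mul_count_le hclosed m n
    have h1 := Real.log_le_log (by nlinarith [hpos m, hpos n]) this
    rw [Real.log_mul (by linarith [hpos m]) (by linarith [hpos n])] at h1
    linarith
  have hbdd : BddBelow (Set.range fun n : ℕ => -Real.log (count D n) / n) := by
    -- The `0` only serves `n = 0`, where the quotient is `0` by convention.
    refine ⟨min 0 (Real.log x), ?_⟩
    rintro _ ⟨n, rfl⟩
    rcases Nat.eq_zero_or_pos n with rfl | hn
    · simp
    refine (min_le_right _ _).trans ?_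
    dsimp only
    have hn' : (0 : ℝ) < n := by exact_mod_cast hn
    rw [le_div_iff₀ hn']
    have h1 := Real.log_le_log (by have := hpos n; positivity)
      (count_sumClosure_mul_pow_le hx.le hw n)
    rw [Real.log_mul (by linarith [hpos n]) (by positivity), Real.log_pow, Real.log_one] at h1
    linarith
  refine ⟨Real.exp (-hsub.lim), ?_⟩
  refine ((Real.continuous_exp.tendsto _).comp (hsub.tendsto_lim hbdd).neg).congr fun n => ?_
  rw [Real.rpow_def_of_pos (by linarith [hpos n])]
  simp only [Function.comp]
  congr 1
  ring

theorem hasGrowthRate_iff_of_tendsto {C : PermClass} {L : ℝ}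
    (h : Tendsto (fun n : ℕ => (count C n : ℝ) ^ (1 / (n : ℝ))) atTop (𝓝 L)) (g : EReal) :
    HasGrowthRate C g ↔ upperGrowthRate C = g := by
  have h' : Tendsto (fun n : ℕ => (((count C n : ℝ) ^ (1 / (n : ℝ)) : ℝ) : EReal)) atTop
      (𝓝 (L : EReal)) := (continuous_coe_real_ereal.tendsto L).comp h
  rw [HasGrowthRate, upperGrowthRate, lowerGrowthRate, h'.limsup_eq, h'.liminf_eq, and_self]

theorem upperGrowthRate_mono {C D : PermClass} (h : C ≤ D) :
    upperGrowthRate C ≤ upperGrowthRate D := by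
  refine limsup_le_limsup (Eventually.of_forall fun n => ?_)
  have := count_mono h n
  simp only [EReal.coe_le_coe_iff]
  gcongr

/-- By continuity the weight stays below `1` at some `x > γ⁻¹`, and then the counts are at most `x⁻¹
^ n` with `x⁻¹ < γ`. -/
theorem upperGrowthRate_sumClosure_lt {π : FinPerm} {γ : ℝ} (hγ : 0 < γ)
    (hw : π.indecWeight γ⁻¹ < 1) : upperGrowthRate (sumClosure (Sub π)) < γ := by
  have hcont : Continuous π.indecWeight := by
    unfold indecWeight
    fun_prop
  have hev : ∀ᶠ x in 𝓝[>] γ⁻¹, π.indecWeight x < 1 :=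
    nhdsWithin_le_nhds (hcont.continuousAt.eventually_lt continuousAt_const hw)
  obtain ⟨x, hxw, hx⟩ := (hev.and self_mem_nhdsWithin).exists
  have hx : γ⁻¹ < x := hx
  have hx0 : 0 < x := lt_trans (by positivity) hx
  refine lt_of_le_of_lt (b := ((x⁻¹ : ℝ) : EReal)) ?_ (by
    exact_mod_cast inv_lt_of_inv_lt₀ hγ hx)
  refine limsup_le_of_le (h := ?_)
  filter_upwards [eventually_ge_atTop 1] with n hn
  rw [EReal.coe_le_coe_iff, rpow_one_div_le (by omega) (by positivity) (by positivity), inv_pow,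
    ← div_le_one₀ (by positivity), div_inv_eq_mul]
  exact count_sumClosure_mul_pow_le hx0.le hxw.le n

/-- For some `y < γ` the counts are eventually at most `y ^ n`, so the generating function of `C`
converges at `γ⁻¹`; its value bounds every finite partial sum. -/
theorem exists_sum_pow_len_le {C : PermClass} {γ : ℝ} (hγ : 0 < γ) (hC : upperGrowthRate C < γ) :
    ∃ M : ℝ, ∀ T : Finset FinPerm, (∀ σ ∈ T, σ ∈ C) → ∑ σ ∈ T, γ⁻¹ ^ σ.len ≤ M := by
  classical
  -- The maximum with `0` guarantees `y > 0`.
  obtain ⟨y, hy, hyγ⟩ := EReal.lt_iff_exists_real_btwn.1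
    (max_lt hC (by exact_mod_cast hγ : ((0 : ℝ) : EReal) < γ))
  have hyγ : y < γ := by exact_mod_cast hyγ
  have hy0 : 0 < y := by exact_mod_cast (le_max_right _ _).trans_lt hy
  have hev := eventually_lt_of_limsup_lt ((le_max_left _ _).trans_lt hy)
  have hsum : Summable fun n : ℕ => (count C n : ℝ) * γ⁻¹ ^ n := by
    refine Summable.of_norm_bounded_eventually_nat
      (summable_geometric_of_lt_one (r := y / γ) (by positivity) ((div_lt_one hγ).2 hyγ)) ?_
    filter_upwards [eventually_ge_atTop 1, hev] with n hn h
    rw [EReal.coe_lt_coe_iff] at h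
    have h1 := (rpow_one_div_le (by omega) (by positivity) hy0.le).1 h.le
    rw [Real.norm_of_nonneg (by positivity), div_pow, inv_pow, ← div_eq_mul_inv]
    gcongr
  refine ⟨∑' n : ℕ, (count C n : ℝ) * γ⁻¹ ^ n, fun T hT => ?_⟩
  calc ∑ σ ∈ T, γ⁻¹ ^ σ.len
      = ∑ n ∈ T.image len, ∑ σ ∈ T with σ.len = n, γ⁻¹ ^ σ.len :=
        (Finset.sum_fiberwise_of_maps_to (fun σ hσ => Finset.mem_image_of_mem _ hσ) _).symm
    _ ≤ ∑ n ∈ T.image len, (count C n : ℝ) * γ⁻¹ ^ n := by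
        refine Finset.sum_le_sum fun n _ => ?_
        rw [Finset.sum_congr rfl fun σ hσ => by rw [(Finset.mem_filter.1 hσ).2], Finset.sum_const,
          nsmul_eq_mul]
        gcongr
        rw [← card_level]
        refine Finset.card_le_card fun σ hσ => ?_
        rw [Finset.mem_filter] at hσ
        exact mem_level.2 ⟨hT σ hσ.1, hσ.2⟩
    _ ≤ _ := hsum.sum_le_tsum _ fun _ _ => by positivity

end PermClass

/-! ### Weights of sums of lists -/

namespace FinPerm

/-- The sum of a list of permutations. -/
def sumList : List FinPerm → FinPerm
  | [] => ⟨0, Equiv.refl _⟩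
  | β :: l => β.sum (sumList l)

open Classical in
/-- The sums `τ₁ ⊕ ⋯ ⊕ τₖ` where `τᵢ` is an indecomposable permutation contained in the `i`-th
member of the list, and `k` is at most the length of the list. -/
noncomputable def prefixSums : List FinPerm → Finset FinPerm
  | [] => {⟨0, Equiv.refl _⟩}
  | β :: l => insert ⟨0, Equiv.refl _⟩
      ((β.indecs ×ˢ prefixSums l).image fun x => x.1.sum x.2)

theorem le_sumList_of_mem_prefixSums {l : List FinPerm} {σ : FinPerm} (h : σ ∈ prefixSums l) :
    σ ≤ sumList l := by
  induction l generalizing σ with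
  | nil =>
    obtain rfl : σ = _ := by simpa [prefixSums] using h
    exact le_rfl
  | cons β l ih =>
    simp only [prefixSums, Finset.mem_insert, Finset.mem_image, Finset.mem_product, Prod.exists,
      mem_indecs] at h
    rcases h with rfl | ⟨τ, ρ, ⟨⟨-, hτ⟩, hρ⟩, rfl⟩
    · exact IsEmb.le (f := id) ⟨fun i (hi : i < 0) => by omega, fun i j _ (hj : j < 0) => by omega,
        fun i j (hi : i < 0) => by omega⟩
    · exact sum_le_sum hτ (ih hρ)

/-- Unique decomposition turns the weight `S` of the prefix sums into the recursion `S (β :: l) = 1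
+ w(β) * S l`, starting from `1`; each `β` thus adds at least `1`. -/
theorem length_lt_sum_prefixSums {l : List FinPerm} {x : ℝ}
    (hl : ∀ β ∈ l, 1 ≤ β.indecWeight x) :
    (l.length : ℝ) < ∑ σ ∈ prefixSums l, x ^ σ.len := by
  classical
  induction l with
  | nil => simp [prefixSums]
  | cons β l ih =>
    have ih := ih fun β hβ => hl β (List.mem_cons_of_mem _ hβ)
    have hβ := hl β List.mem_cons_self
    rw [prefixSums, Finset.sum_insert, Finset.sum_image]
    · simp only [len_sum, pow_add, pow_zero, List.length_cons]
      rw [Finset.sum_product]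
      dsimp only
      rw [← Finset.sum_mul_sum]
      have : (0 : ℝ) ≤ l.length := by positivity
      push_cast
      unfold indecWeight at hβ
      nlinarith
    · rintro ⟨τ, ρ⟩ h ⟨τ', ρ'⟩ h' he
      simp only [Finset.coe_product, Set.mem_prod, Finset.mem_coe, mem_indecs] at h h'
      obtain ⟨rfl, rfl⟩ := h.1.1.sum_inj h'.1.1 he
      rfl
    · simp only [Finset.mem_image, Finset.mem_product, mem_indecs, Prod.exists, not_exists, not_and]
      intro τ ρ h he
      have := h.1.1.1
      have := congrArg len he
      simp only [len_sum] at this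
      omega

/-- Copies of permutations in `π`, each above and to the right of the previous ones, form a copy
of their sum. -/
theorem exists_isEmb_sumList {ι : Type*} {π : FinPerm} {β : ι → FinPerm} {f : ι → ℕ → ℕ}
    (l : List ι) (hf : ∀ i ∈ l, IsEmb (f i) (β i) π)
    (hl : l.Pairwise fun i j => ∀ x < (β i).len, ∀ y < (β j).len,
      f i x < f j y ∧ π.val (f i x) < π.val (f j y)) :
    ∃ g, IsEmb g (sumList (l.map β)) π ∧
      ∀ x < (sumList (l.map β)).len, ∃ i ∈ l, ∃ y < (β i).len, g x = f i y := by
  induction l with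
  | nil =>
    exact ⟨id, ⟨fun i (hi : i < 0) => by omega, fun i j _ (hj : j < 0) => by omega,
        fun i j (hi : i < 0) => by omega⟩, fun i (hi : i < 0) => by omega⟩
  | cons i l ih =>
    rw [List.pairwise_cons] at hl
    obtain ⟨g, hg, hg'⟩ := ih (fun j hj => hf j (List.mem_cons_of_mem _ hj)) hl.2
    have key : ∀ x y, x < (β i).len → y < (sumList (l.map β)).len →
        f i x < g y ∧ π.val (f i x) < π.val (g y) := fun x y hx hy => by
      obtain ⟨j, hj, z, hz, e⟩ := hg' y hy
      rw [e]
      exact hl.1 j hj x hx z hz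
    refine ⟨_, (hf i List.mem_cons_self).sum hg (fun x y hx hy => (key x y hx hy).1)
      (fun x y hx hy => (key x y hx hy).2), fun x hx => ?_⟩
    by_cases h : x < (β i).len
    · exact ⟨i, List.mem_cons_self, x, h, by simp [h]⟩
    · obtain ⟨j, hj, z, hz, e⟩ := hg' (x - (β i).len) (by
        simp only [List.map_cons, sumList, len_sum] at hx
        omega)
      exact ⟨j, List.mem_cons_of_mem _ hj, z, hz, by simp [h, e]⟩

end FinPerm

/-! ### Complemented classes and the class of cells -/

namespace PermClass

open FinPerm

/-- The class of the complements of the members of `C`. -/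
def compClass (C : PermClass) : PermClass :=
  ⟨{σ | σ.comp ∈ C}, fun _ _ h h' => C.lower (comp_le_comp h) h'⟩

@[simp] theorem mem_compClass {C : PermClass} {σ : FinPerm} : σ ∈ compClass C ↔ σ.comp ∈ C :=
  Iff.rfl

theorem count_compClass (C : PermClass) (n : ℕ) : count (compClass C) n = count C n := by
  rw [← card_level, ← card_level]
  refine Finset.card_bij' (fun σ _ => σ.comp) (fun σ _ => σ.comp) ?_ ?_ ?_ ?_ <;> simp

theorem upperGrowthRate_compClass (C : PermClass) :
    upperGrowthRate (compClass C) = upperGrowthRate C := by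
  simp only [upperGrowthRate, count_compClass]

theorem lowerGrowthRate_compClass (C : PermClass) :
    lowerGrowthRate (compClass C) = lowerGrowthRate C := by
  simp only [lowerGrowthRate, count_compClass]

/-- Complementation exchanges sums and skew sums while preserving containment and length, so every
skew statement reduces to a sum statement. -/
theorem skewClosure_Sub (π : FinPerm) :
    skewClosure (Sub π) = compClass (sumClosure (Sub π.comp)) := by
  apply le_antisymm
  · refine sInf_le ⟨fun σ hσ τ hτ => ?_, fun σ hσ => ?_⟩
    · rw [mem_compClass, comp_skewSum]
      exact sumClosed_sumClosure _ _ hσ _ hτ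
    · exact le_sumClosure _ (comp_le_comp (show σ ≤ π from hσ))
  · have h : sumClosure (Sub π.comp) ≤ compClass (skewClosure (Sub π)) := by
      refine sumClosure_le (fun σ hσ τ hτ => ?_) fun σ hσ => ?_
      · rw [mem_compClass, comp_sum]
        simp only [mem_compClass, skewClosure, LowerSet.mem_sInf_iff] at *
        exact fun D hD => hD.1 _ (hσ D hD) _ (hτ D hD)
      · change σ.comp ∈ skewClosure (Sub π)
        rw [skewClosure, LowerSet.mem_sInf_iff]
        exact fun D hD => hD.2 (comp_le_iff.2 hσ)
    intro σ hσ
    simpa using h hσ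

theorem mem_cellSet {γ : ℝ} {π : FinPerm} : π ∈ cellSet γ ↔
    upperGrowthRate (sumClosure (Sub π)) < γ ∨ upperGrowthRate (sumClosure (Sub π.comp)) < γ := by
  obtain ⟨L, hL⟩ := exists_tendsto_count_sumClosure π
  obtain ⟨L', hL'⟩ := exists_tendsto_count_sumClosure π.comp
  have h := hasGrowthRate_iff_of_tendsto hL
  have h' := hasGrowthRate_iff_of_tendsto hL'
  simp only [cellSet, Set.mem_ofPred_eq, skewClosure_Sub]
  simp only [HasGrowthRate, upperGrowthRate_compClass, lowerGrowthRate_compClass] at h h' ⊢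
  simp only [exists_eq_left', h', h]

/-- `cellSet γ` as a permutation class. -/
def cellClass (γ : ℝ) : PermClass :=
  ⟨cellSet γ, fun π σ h hπ => by
    have key : ∀ {σ π : FinPerm}, σ ≤ π →
        upperGrowthRate (sumClosure (Sub σ)) ≤ upperGrowthRate (sumClosure (Sub π)) := fun h =>
      upperGrowthRate_mono (sumClosure_mono (LowerSet.Iic_le.2 h))
    rw [mem_cellSet] at *
    exact hπ.imp (key h).trans_lt (key (comp_le_comp h)).trans_lt⟩

theorem mem_cellClass {γ : ℝ} {π : FinPerm} : π ∈ cellClass γ ↔ π ∈ cellSet γ := Iff.rfl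

theorem one_le_indecWeight {γ : ℝ} (hγ : 0 < γ) {π : FinPerm} (h : π ∉ cellClass γ) :
    1 ≤ π.indecWeight γ⁻¹ ∧ 1 ≤ π.comp.indecWeight γ⁻¹ := by
  rw [mem_cellClass, mem_cellSet, not_or] at h
  constructor <;> by_contra hlt
  · exact h.1 (upperGrowthRate_sumClosure_lt hγ (not_le.1 hlt))
  · exact h.2 (upperGrowthRate_sumClosure_lt hγ (not_le.1 hlt))

/-- The weight is at most `γ⁻¹ < 1`. Consequently bad rectangles have width and height at least `2`,
as the greedy subdivision requires. -/
theorem mem_cellClass_of_len_le_one {γ : ℝ} (hγ : 1 < γ) {π : FinPerm} (h : π.len ≤ 1) :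
    π ∈ cellClass γ := by
  by_contra hcon
  have h1 := (one_le_indecWeight (by linarith) hcon).1
  have h2 := indecWeight_le_of_len_le_one h (x := γ⁻¹) (by positivity)
  have h3 := inv_lt_one_of_one_lt₀ hγ
  linarith

/-- A class of upper growth rate less than `γ` does not contain long sums of permutations whose
indecomposable subpermutations have total weight at least `1`. -/
theorem exists_forall_sumList_notMem {C : PermClass} {γ : ℝ} (hγ : 0 < γ)
    (hC : upperGrowthRate C < γ) : ∃ m : ℕ, ∀ l : List FinPerm, m ≤ l.length →
      (∀ β ∈ l, 1 ≤ β.indecWeight γ⁻¹) → sumList l ∉ C := by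
  obtain ⟨M, hM⟩ := exists_sum_pow_len_le hγ hC
  obtain ⟨m, hm⟩ := exists_nat_ge M
  refine ⟨m, fun l hl hw hmem => ?_⟩
  have h1 := hM (prefixSums l) fun σ hσ => C.lower (le_sumList_of_mem_prefixSums hσ) hmem
  have h2 := length_lt_sum_prefixSums hw
  have h3 : (m : ℝ) ≤ l.length := by exact_mod_cast hl
  linarith

end PermClass

/-! ### Chains, cuts and Ramsey's theorem for rectangles -/

/-- Greedy subdivision: a monotone property `Q` of intervals either holds for `k` consecutive
intervals, or at most `2 * k` points meet the interior of every interval with the property. -/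
theorem exists_chain_or_cuts {Q : ℕ → ℕ → Prop}
    (mono : ∀ a b a' b', a' ≤ a → b ≤ b' → Q a b → Q a' b') (hQ : ∀ a b, Q a b → a + 1 < b)
    (k s : ℕ) :
    (∃ e : ℕ → ℕ, Monotone e ∧ s ≤ e 0 ∧ ∀ j < k, Q (e j) (e (j + 1))) ∨
    ∃ D : Finset ℕ, D.card ≤ 2 * k ∧
      ∀ x y, s ≤ x → (∀ z ∈ D, ¬ (x < z ∧ z < y)) → ¬ Q x y := by
  classical
  induction k generalizing s with
  | zero => exact Or.inl ⟨fun _ => s, monotone_const, le_rfl, fun j hj => by omega⟩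
  | succ k ih =>
    by_cases hex : ∃ b, Q s b
    swap
    · exact Or.inr ⟨∅, by simp, fun x y hx _ h => hex ⟨y, mono _ _ _ _ hx le_rfl h⟩⟩
    -- Greedy choice: `b` is the earliest end of a `Q`-interval starting at `s`, and the search
    -- continues from `b`.
    have hb := Nat.find_spec hex
    have hmin : ∀ y, Q s y → Nat.find hex ≤ y := fun y hy => Nat.find_min' hex hy
    generalize Nat.find hex = b at *
    have hsb := hQ _ _ hb
    rcases ih b with ⟨e, he, hbe, hchain⟩ | ⟨D, hD, hcut⟩
    · refine Or.inl ⟨fun j => Nat.casesOn j s e, monotone_nat_of_le_succ fun j => ?_, le_rfl,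
        fun j hj => ?_⟩
      · cases j with
        | zero => exact (show s ≤ e 0 by omega)
        | succ j => exact he (Nat.le_succ j)
      · cases j with
        | zero => exact mono _ _ _ _ le_rfl hbe hb
        | succ j => exact hchain j (by omega)
    -- Two cuts per step: an uncut `Q`-interval has `y ≥ b` by minimality, so `b - 1` forces `x ≥ b
    -- - 1`; if `x = b - 1` then `y > b` by `hQ` and `b` would cut it. So `x ≥ b`, where `D`
    -- applies.
    · refine Or.inr ⟨insert (b - 1) (insert b D), ?_, fun x y hx hz h => ?_⟩
      · have := Finset.card_insert_le (b - 1) (insert b D)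
        have := Finset.card_insert_le b D
        omega
      · have h1 := hz (b - 1) (by simp)
        have h2 := hz b (by simp)
        have h3 := hQ _ _ h
        have h4 := hmin y (mono _ _ _ _ hx le_rfl h)
        exact hcut x y (by omega) (fun z hzD => hz z (by simp [hzD])) h

/-- Given as many increasing sequences as each has gaps, one can choose a gap in each of them so
that the chosen gaps are disjoint. -/
theorem exists_disjoint_gaps {ι : Type*} {e : ι → ℕ → ℕ} (k r h : ℕ) (S : Finset ι)
    (hS : S.card = k) (hmono : ∀ i ∈ S, Monotone (e i)) (hh : ∀ i ∈ S, h ≤ e i r) :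
    ∃ j : ι → ℕ, (∀ i ∈ S, j i < r + k ∧ h ≤ e i (j i)) ∧
      ∀ i ∈ S, ∀ i' ∈ S, i ≠ i' →
        e i (j i + 1) ≤ e i' (j i') ∨ e i' (j i' + 1) ≤ e i (j i) := by
  classical
  induction k generalizing r h S with
  | zero =>
    obtain rfl := Finset.card_eq_zero.1 hS
    exact ⟨fun _ => 0, by simp, by simp⟩
  | succ k ih =>
    -- The sequence whose term `r + 1` is smallest takes its gap `r`; all others have reached that
    -- height by index `r + 1` and continue above it.
    obtain ⟨i₀, hi₀, hmin⟩ := S.exists_min_image (fun i => e i (r + 1))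
      (Finset.card_pos.1 (by omega))
    obtain ⟨j, hj, hdisj⟩ := ih (r + 1) (e i₀ (r + 1)) (S.erase i₀)
      (by rw [Finset.card_erase_of_mem hi₀]; omega)
      (fun i hi => hmono i (Finset.mem_of_mem_erase hi))
      (fun i hi => hmin i (Finset.mem_of_mem_erase hi))
    refine ⟨fun i => if i = i₀ then r else j i, fun i hi => ?_, fun i hi i' hi' hne => ?_⟩
    · by_cases hii : i = i₀
      · subst hii
        simpa using hh i hi
      · have := hj i (Finset.mem_erase.2 ⟨hii, hi⟩)
        have h1 := hh i₀ hi₀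
        have h2 := hmono i₀ hi₀ (Nat.le_succ r)
        simp only [hii, if_false]
        simp only [Nat.succ_eq_add_one] at h2
        omega
    · by_cases h1 : i = i₀ <;> by_cases h2 : i' = i₀
      · exact absurd (h1.trans h2.symm) hne
      · subst h1
        left
        simpa [h2] using (hj i' (Finset.mem_erase.2 ⟨h2, hi'⟩)).2
      · subst h2
        right
        simpa [h1] using (hj i (Finset.mem_erase.2 ⟨h1, hi⟩)).2
      · simpa [h1, h2] using
          hdisj i (Finset.mem_erase.2 ⟨h1, hi⟩) i' (Finset.mem_erase.2 ⟨h2, hi'⟩) hne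

/-- Ramsey's theorem for two colours, for a list of vertices. -/
theorem exists_sublist_pairwise {ι : Type*} {R S : ι → ι → Prop} (a b : ℕ) (l : List ι)
    (hl : l.Pairwise fun i j => R i j ∨ S i j) (hlen : 2 ^ (a + b) ≤ l.length) :
    ∃ l' : List ι, l'.Sublist l ∧
      ((l'.length = a ∧ l'.Pairwise R) ∨ (l'.length = b ∧ l'.Pairwise S)) := by
  classical
  induction hn : a + b generalizing a b l with
  | zero =>
    obtain rfl : a = 0 := by omega
    exact ⟨[], List.nil_sublist _, Or.inl ⟨rfl, List.Pairwise.nil⟩⟩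
  | succ n ih =>
    rcases a with _ | a
    · exact ⟨[], List.nil_sublist _, Or.inl ⟨rfl, List.Pairwise.nil⟩⟩
    rcases b with _ | b
    · exact ⟨[], List.nil_sublist _, Or.inr ⟨rfl, List.Pairwise.nil⟩⟩
    rcases l with _ | ⟨v, t⟩
    · simp at hlen
    rw [List.pairwise_cons] at hl
    -- Beyond `v` there are at least `2 ^ (n + 1) - 1` vertices, so one colour at `v` occurs `2 ^ n`
    -- times.
    have hsplit := t.length_eq_length_filter_add fun j => decide (R v j)
    rw [hn, pow_succ, List.length_cons] at hlen
    by_cases hR : 2 ^ n ≤ (t.filter fun j => decide (R v j)).length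
    · obtain ⟨l', hl', h⟩ := ih a (b + 1) _ (hl.2.filter _) (by convert hR using 2; omega)
        (by omega)
      rcases h with ⟨h, hp⟩ | ⟨h, hp⟩
      · refine ⟨v :: l', (hl'.trans List.filter_sublist).cons_cons v,
          Or.inl ⟨by simp [h], List.pairwise_cons.2 ⟨fun j hj => ?_, hp⟩⟩⟩
        simpa using (List.mem_filter.1 (hl'.subset hj)).2
      · exact ⟨l', (hl'.trans List.filter_sublist).cons v, Or.inr ⟨h, hp⟩⟩
    · obtain ⟨l', hl', h⟩ := ih (a + 1) b (t.filter fun j => !decide (R v j)) (hl.2.filter _)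
        (by rw [show a + 1 + b = n by omega]; omega) (by omega)
      rcases h with ⟨h, hp⟩ | ⟨h, hp⟩
      · exact ⟨l', (hl'.trans List.filter_sublist).cons v, Or.inl ⟨h, hp⟩⟩
      · refine ⟨v :: l', (hl'.trans List.filter_sublist).cons_cons v,
          Or.inr ⟨by simp [h], List.pairwise_cons.2 ⟨fun j hj => ?_, hp⟩⟩⟩
        have := List.mem_filter.1 (hl'.subset hj)
        exact (hl.1 j this.1).resolve_left (by simpa using this.2)

/-- Divisions of `[s, n)` into `t + 1` parts that include the given points, if at most `t` of
these are in the interior. -/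
theorem exists_divisions (t : ℕ) {s n : ℕ} (hs : s ≤ n) (D : Finset ℕ)
    (hD : (D.filter fun z => s < z ∧ z < n).card ≤ t) :
    ∃ c : ℕ → ℕ, Monotone c ∧ c 0 = s ∧ c (t + 1) = n ∧
      ∀ i ≤ t, ∀ z ∈ D, ¬ (c i < z ∧ z < c (i + 1)) := by
  induction t generalizing s with
  | zero =>
    refine ⟨fun i => if i = 0 then s else n, monotone_nat_of_le_succ fun i => ?_, rfl, by simp,
      fun i hi z hz h => ?_⟩
    · by_cases h : i = 0 <;> simp [h, hs]
    · obtain rfl : i = 0 := by omega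
      have hmem : z ∈ D.filter fun z => s < z ∧ z < n := Finset.mem_filter.2 ⟨hz, by simpa using h⟩
      simp [Finset.card_eq_zero.1 (Nat.le_zero.1 hD)] at hmem
  | succ t ih =>
    -- The first division is the least interior point of `D`, or `n` if there is none, the remaining
    -- parts then being empty.
    have hmin : ∃ m, s ≤ m ∧ m ≤ n ∧ (D.filter fun z => m < z ∧ z < n).card ≤ t ∧
        ∀ z ∈ D, ¬ (s < z ∧ z < m) := by
      rcases (D.filter fun z => s < z ∧ z < n).eq_empty_or_nonempty with he | hne
      · refine ⟨n, hs, le_rfl, ?_, fun z hz h => ?_⟩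
        · rw [Finset.filter_false_of_mem fun z _ => by omega]
          simp
        · have : z ∈ D.filter fun z => s < z ∧ z < n := Finset.mem_filter.2 ⟨hz, h⟩
          simp [he] at this
      · have hmem := Finset.min'_mem _ hne
        have hle : ∀ z ∈ _, Finset.min' _ hne ≤ z := fun z hz => Finset.min'_le _ z hz
        generalize Finset.min' _ hne = m at *
        have hm := (Finset.mem_filter.1 hmem).2
        refine ⟨m, hm.1.le, hm.2.le, ?_, fun z hz h => ?_⟩
        · refine Nat.le_of_lt_succ (lt_of_lt_of_le (Finset.card_lt_card ?_) hD)
          refine Finset.ssubset_iff_of_subset ?_ |>.2 ⟨m, hmem, by simp⟩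
          exact fun z hz => by
            rw [Finset.mem_filter] at hz ⊢
            exact ⟨hz.1, by omega, hz.2.2⟩
        · have := hle z (Finset.mem_filter.2 ⟨hz, h.1, by omega⟩)
          omega
    obtain ⟨m, hsm, hmn, hcard, hgap⟩ := hmin
    obtain ⟨c, hc, hc0, hct, hcut⟩ := ih hmn hcard
    refine ⟨fun j => Nat.casesOn j s c, monotone_nat_of_le_succ fun j => ?_, rfl, hct,
      fun j hj z hz => ?_⟩
    · cases j with
      | zero => exact (show s ≤ c 0 by omega)
      | succ j => exact hc (Nat.le_succ j)
    · cases j with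
      | zero => exact (show ¬ (s < z ∧ z < c 0) by rw [hc0]; exact hgap z hz)
      | succ j => exact hcut j (by omega) z hz

/-- A monotone family of bad rectangles either contains an array of `N` slabs with `N` consecutive
rectangles in each, or it is avoided by a grid of bounded size. -/
theorem exists_array_or_grid {bad : ℕ → ℕ → ℕ → ℕ → Prop}
    (mono : ∀ a b c d a' b' c' d', a' ≤ a → b ≤ b' → c' ≤ c → d ≤ d' → bad a b c d →
      bad a' b' c' d')
    (hwidth : ∀ a b c d, bad a b c d → a + 1 < b) (hheight : ∀ a b c d, bad a b c d → c + 1 < d)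
    {N : ℕ} (hN : 0 < N) (n : ℕ) :
    (∃ (s : ℕ → ℕ) (e : ℕ → ℕ → ℕ), Monotone s ∧ (∀ i < N, Monotone (e i)) ∧
      ∀ i < N, ∀ j < N, bad (s i) (s (i + 1)) (e i j) (e i (j + 1))) ∨
    ∃ c r : ℕ → ℕ, Monotone c ∧ c 0 = 0 ∧ c (2 * N + 1) = n ∧
      Monotone r ∧ r 0 = 0 ∧ r ((2 * N + 1) * (2 * N) + 1) = n ∧
      ∀ i ≤ 2 * N, ∀ j ≤ (2 * N + 1) * (2 * N), ¬ bad (c i) (c (i + 1)) (r j) (r (j + 1)) := by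
  classical
  -- A slab has `Q` if it holds `N` stacked bad rectangles. If few cuts destroy all such slabs, the
  -- greedy lemma applies again inside each column.
  let Q : ℕ → ℕ → Prop := fun a b =>
    ∃ e : ℕ → ℕ, Monotone e ∧ ∀ j < N, bad a b (e j) (e (j + 1))
  rcases exists_chain_or_cuts (Q := Q)
    (fun a b a' b' ha hb ⟨e, he, h⟩ =>
      ⟨e, he, fun j hj => mono _ _ _ _ _ _ _ _ ha hb le_rfl le_rfl (h j hj)⟩)
    (fun a b ⟨e, _, h⟩ => hwidth _ _ _ _ (h 0 hN)) N 0 with ⟨s, hs, -, h⟩ | ⟨D, hD, hcut⟩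
  · left
    have : ∀ i, ∃ e : ℕ → ℕ, i < N →
        Monotone e ∧ ∀ j < N, bad (s i) (s (i + 1)) (e j) (e (j + 1)) := fun i => by
      by_cases hi : i < N
      · obtain ⟨e, he⟩ := h i hi
        exact ⟨e, fun _ => he⟩
      · exact ⟨id, fun h => absurd h hi⟩
    choose e he using this
    exact ⟨s, e, hs, fun i hi => (he i hi).1, fun i hi => (he i hi).2⟩
  · right
    obtain ⟨c, hc, hc0, hcn, hcD⟩ := exists_divisions (2 * N) (Nat.zero_le n) D
      ((Finset.card_filter_le _ _).trans hD)
    have : ∀ i, ∃ E : Finset ℕ, i ≤ 2 * N → E.card ≤ 2 * N ∧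
        ∀ x y, (∀ z ∈ E, ¬ (x < z ∧ z < y)) → ¬ bad (c i) (c (i + 1)) x y := fun i => by
      by_cases hi : i ≤ 2 * N
      · rcases exists_chain_or_cuts (Q := bad (c i) (c (i + 1)))
          (fun a b a' b' ha hb => mono _ _ _ _ _ _ _ _ le_rfl le_rfl ha hb)
          (fun a b => hheight _ _ _ _) N 0 with ⟨e, he, -, h⟩ | ⟨E, hE, hEcut⟩
        · exact absurd ⟨e, he, h⟩ (hcut (c i) (c (i + 1)) (Nat.zero_le _) (hcD i hi))
        · exact ⟨E, fun _ => ⟨hE, fun x y => hEcut x y (Nat.zero_le _)⟩⟩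
      · exact ⟨∅, fun h => absurd h hi⟩
    choose E hE using this
    -- Row divisions must serve all columns at once, so the cuts of the `2 * N + 1` columns are
    -- united.
    have hcard : ((Finset.range (2 * N + 1)).biUnion E).card ≤ (2 * N + 1) * (2 * N) := by
      refine (Finset.card_biUnion_le_card_mul _ _ (2 * N) fun i hi => (hE i ?_).1).trans (by simp)
      have := Finset.mem_range.1 hi
      omega
    obtain ⟨r, hr, hr0, hrn, hrE⟩ := exists_divisions _ (Nat.zero_le n) _
      ((Finset.card_filter_le _ _).trans hcard)
    refine ⟨c, r, hc, hc0, hcn, hr, hr0, hrn, fun i hi j hj => (hE i hi).2 _ _ fun z hz => ?_⟩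
    exact hrE j hj z (Finset.mem_biUnion.2 ⟨i, Finset.mem_range.2 (by omega), hz⟩)

/-- An array of rectangles as above contains a long increasing or a long decreasing sequence of
rectangles, one from each of a sequence of slabs. -/
theorem exists_monotone_boxes {m N : ℕ} (hN : 2 ^ (m + m) ≤ N) {e : ℕ → ℕ → ℕ}
    (he : ∀ i < N, Monotone (e i)) :
    ∃ (j : ℕ → ℕ) (l : List ℕ), l.length = m ∧ (∀ i ∈ l, i < N ∧ j i < N) ∧
      (l.Pairwise (fun i i' => i < i' ∧ e i (j i + 1) ≤ e i' (j i')) ∨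
        l.Pairwise (fun i i' => i < i' ∧ e i' (j i' + 1) ≤ e i (j i))) := by
  obtain ⟨j, hj, hdisj⟩ := exists_disjoint_gaps (e := e) N 0 0 (Finset.range N) (by simp)
    (fun i hi => he i (Finset.mem_range.1 hi)) (fun i _ => Nat.zero_le _)
  have hpair : (List.range N).Pairwise fun i i' => (i < i' ∧ e i (j i + 1) ≤ e i' (j i')) ∨
      (i < i' ∧ e i' (j i' + 1) ≤ e i (j i)) := by
    refine List.Pairwise.imp_of_mem ?_ List.pairwise_lt_range
    intro i i' hi hi' hlt
    have := hdisj i (by simpa using hi) i' (by simpa using hi') hlt.ne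
    exact this.imp (⟨hlt, ·⟩) (⟨hlt, ·⟩)
  obtain ⟨l, hl, h⟩ := exists_sublist_pairwise m m _ hpair (by simpa using hN)
  refine ⟨j, l, h.elim And.left And.left, fun i hi => ?_, h.imp And.right And.right⟩
  have hi : i < N := by simpa using hl.subset hi
  exact ⟨hi, by simpa using (hj i (Finset.mem_range.2 hi)).1⟩

/-! ### Griddability -/

namespace PermClass

open FinPerm

theorem isGriddable_cellClass {γ : ℝ} (hγ : 1 < γ) {C : PermClass} (hC : upperGrowthRate C < γ) :
    IsGriddable C (cellClass γ) := by
  have hγ0 : 0 < γ := by linarith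
  obtain ⟨m₁, hm₁⟩ := exists_forall_sumList_notMem hγ0 hC
  obtain ⟨m₂, hm₂⟩ := exists_forall_sumList_notMem hγ0
    ((upperGrowthRate_compClass C).trans_lt hC)
  -- `m` excludes both increasing chains, via `C`, and decreasing ones, via the complements; `N` is
  -- the matching Ramsey bound.
  set m := max m₁ m₂ with hm
  set N := 2 ^ (m + m) with hN
  have hN0 : 0 < N := by positivity
  refine ⟨2 * N + 1, (2 * N + 1) * (2 * N) + 1, by omega, by omega, fun _ _ => cellClass γ,
    fun _ _ => rfl, fun π hπ => ?_⟩
  rcases exists_array_or_grid (bad := fun a b c d => π.box a b c d ∉ cellClass γ)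
    (fun a b c d a' b' c' d' ha hb hc hd h h' =>
      h ((cellClass γ).lower (box_mono π ha hb hc hd) h'))
    (fun a b c d h => by
      by_contra hlt
      exact h (mem_cellClass_of_len_le_one hγ ((len_box_le_width π a b c d).trans (by omega))))
    (fun a b c d h => by
      by_contra hlt
      exact h (mem_cellClass_of_len_le_one hγ ((len_box_le_height π a b c d).trans (by omega))))
    hN0 π.len with ⟨s, e, hs, he, hbad⟩ | ⟨c, r, hc, hc0, hcn, hr, hr0, hrn, hgood⟩
  · exfalso
    obtain ⟨j, l, hlen, hlN, hl⟩ := exists_monotone_boxes hN.ge he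
    let β : ℕ → FinPerm := fun i => π.box (s i) (s (i + 1)) (e i (j i)) (e i (j i + 1))
    have hβ : ∀ i ∈ l, 1 ≤ (β i).indecWeight γ⁻¹ ∧ 1 ≤ (β i).comp.indecWeight γ⁻¹ := fun i hi =>
      one_le_indecWeight hγ0 (hbad i (hlN i hi).1 (j i) (hlN i hi).2)
    have hemb : ∀ i, ∃ f, IsEmb f (β i) π ∧ ∀ x < (β i).len, s i ≤ f x ∧ f x < s (i + 1) ∧
        e i (j i) ≤ π.val (f x) ∧ π.val (f x) < e i (j i + 1) := fun i => exists_isEmb_box π _ _ _ _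
    choose f hf hfbox using hemb
    have hpos : ∀ i i', i < i' → ∀ x < (β i).len, ∀ y < (β i').len, f i x < f i' y :=
      fun i i' hlt x hx y hy =>
        (hfbox i x hx).2.1.trans_le ((hs (Nat.succ_le_of_lt hlt)).trans (hfbox i' y hy).1)
    rcases hl with hl | hl
    · obtain ⟨g, hg, -⟩ := exists_isEmb_sumList (f := f) (β := β) (π := π) l (fun i _ => hf i)
        (hl.imp fun {i i'} h x hx y hy => ⟨hpos i i' h.1 x hx y hy,
          (hfbox i x hx).2.2.2.trans_le (h.2.trans (hfbox i' y hy).2.2.1)⟩)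
      refine hm₁ (l.map β) (by simp [hlen, hm]) (fun b hb => ?_) (C.lower hg.le hπ)
      obtain ⟨i, hi, rfl⟩ := List.mem_map.1 hb
      exact (hβ i hi).1
    -- A decreasing chain in `π` is an increasing one in `π.comp`, at the same positions.
    · obtain ⟨g, hg, -⟩ := exists_isEmb_sumList (f := f) (β := fun i => (β i).comp) (π := π.comp) l
        (fun i _ => (hf i).comp)
        (hl.imp fun {i i'} h x hx y hy => ⟨hpos i i' h.1 x hx y hy, by
          have hx' := (hf i).1 x hx
          have hy' := (hf i').1 y hy
          rw [val_comp π hx', val_comp π hy']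
          have := (hfbox i' y hy).2.2.2.trans_le (h.2.trans (hfbox i x hx).2.2.1)
          have := π.val_lt hx'
          omega⟩)
      refine hm₂ (l.map fun i => (β i).comp) (by simp [hlen, hm]) (fun b hb => ?_)
        ((compClass C).lower hg.le (by simpa using hπ))
      obtain ⟨i, hi, rfl⟩ := List.mem_map.1 hb
      exact (hβ i hi).2
  · refine ⟨fun i => c i, fun i => r i, fun i i' h => hc h, by simpa using hc0, by simpa using hcn,
      fun i i' h => hr h, by simpa using hr0, by simpa using hrn, fun i i' => ?_⟩
    simpa using hgood i (by omega) i' (by omega)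

end PermClass

/-- The set of permutations `cellSet γ` is a permutation class, and every permutation class of
upper growth rate less than `γ` is griddable by it. -/
theorem mainTheorem5 (γ : ℝ) (hγ : 1 < γ) (C : PermClass)
    (hC : PermClass.upperGrowthRate C < (γ : EReal)) :
    ∃ G : PermClass, (G : Set FinPerm) = PermClass.cellSet γ ∧ PermClass.IsGriddable C G := by
  exact ⟨PermClass.cellClass γ, rfl, PermClass.isGriddable_cellClass hγ hC⟩
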